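/- **Conventions.** All metric spaces are complete and separable. $\mathrm{Geo}(X)$ is the set of constant speed geodesics of a metric space $(X,d)$, i.e. maps $\gamma:[0,1]\to X$ with $d(\gamma_s,\gamma_t)=|t-s|\,d(\gamma_0,\gamma_1)$ for all $s,t\in[0,1]$, with the distance $\max_t d(\gamma_t,\gamma'_t)$, and $e_t(\gamma)=\gamma_t$. $X$ is *geodesic* if any two points $x,y$ are $\gamma_0,\gamma_1$ for some $\gamma\in\mathrm{Geo}(X)$. A geodesic space is *non-branching* if $\gamma,\gamma'\in\mathrm{Geo}(X)$ with $\gamma_0=\gamma'_0$ and $\gamma_s=\gamma'_s$ for some $s\in(0,1)$ always coincide, and *strongly non-branching* if $$\liminf_{t\downarrow0}\frac{d(\gamma_t,\gamma'_t)}{d(\gamma_0,\gamma_t)}>0$$ for all $\gamma,\gamma'\in\mathrm{Geo}(X)$ with $\gamma_0=\gamma_0'$, $\gamma_1\neq\gamma_1'$ and $d(\gamma_0,\gamma_1)>0$. A Borel measure $m$, finite on bounded sets, is *doubling* if for some $0<C<\infty$ one has $m(B(x,2r))\le C\,m(B(x,r))$ for all $x\in X$, $0<r<\mathrm{diam}(X)$.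 A metric space $Y$ is *tangent* to $X$ at $x$ if there are $r_n\downarrow0$ and $y\in Y$ such that, for every $R>0$, the closed balls of radius $R$ about $x$ in $(X,d/r_n)$ converge to the closed ball of radius $R$ about $y$ in $Y$ in the Gromov–Hausdorff distance. For Borel probability measures $\mu,\nu$ on $X$, $W_2^2(\mu,\nu)=\inf_\sigma\int d^2(x,y)\,d\sigma(x,y)\in[0,\infty]$ over all couplings $\sigma$ of $\mu$ and $\nu$. If $W_2(\mu,\nu)<\infty$, $\mathrm{GeoOpt}(\mu,\nu)$ is the set of Borel probability measures $\pi$ on $\mathrm{Geo}(X)$ with $(e_0)_\#\pi=\mu$, $(e_1)_\#\pi=\nu$ and $\int d^2(\gamma_0,\gamma_1)\,d\pi(\gamma)=W_2^2(\mu,\nu)$. **Theorem.** Let $(X,d)$ be a complete separable strongly non-branching geodesic metric space with a doubling measure $m$, and let $\mu=\rho m$ and $\nu$ be Borel probability measures on $X$ with $W_2(\mu,\nu)<\infty$. Assume that (a) for $m$-a.e. $x\in X$ there is a non-branching geodesic space (complete and separable) that is tangent to $X$ at $x$; (b) $\pi\in\mathrm{GeoOpt}(\mu,\nu)$ is such that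 $(e_s)_\#\pi\ll m$ for all sufficiently small $s\in[0,1)$, and the densities $\rho_s$ satisfy $$\limsup_{s\downarrow0}\int_X\rho_s\log\rho_s\,dm<\infty,$$ where the integral takes values in $[-\infty,\infty]$ (positive part minus negative part) and is set to $+\infty$ if the positive part has infinite integral. Then there is a Borel map $T:X\to X$ such that $\gamma_1=T(\gamma_0)$ for $\pi$-a.e. $\gamma\in\mathrm{Geo}(X)$. -/

import Mathlib

open Set Filter Topology MeasureTheory
open scoped ENNReal NNReal unitInterval

universe u

/-- The constant speed geodesics of `X`, parametrized by `[0,1]`. -/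
@[ext]
structure Geo (X : Type u) [MetricSpace X] : Type u where
  toMap : C(I, X)
  dist_eq : ∀ s t : I,
    dist (toMap s) (toMap t) = |(t : ℝ) - (s : ℝ)| * dist (toMap 0) (toMap 1)

namespace Geo

variable {X : Type u} [MetricSpace X]

/-- `γ t` is the point of the geodesic `γ` at time `t`. -/
instance : CoeFun (Geo X) (fun _ => I → X) := ⟨fun γ => γ.toMap⟩

/-- The distance on `Geo X` is the uniform distance `max_t d(γ_t, γ'_t)`. -/
noncomputable instance : MetricSpace (Geo X) :=
  MetricSpace.induced Geo.toMap (fun _ _ h => Geo.ext h) inferInstance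

/-- `Geo X` carries its Borel sigma-algebra. -/
noncomputable instance : MeasurableSpace (Geo X) := borel (Geo X)

instance : BorelSpace (Geo X) := ⟨rfl⟩

/-- The evaluation map `e_t`. -/
def eval (t : I) (γ : Geo X) : X := γ t

end Geo

/-- Any two points are joined by a (constant speed) geodesic. -/
def IsGeodesicSpace (X : Type u) [MetricSpace X] : Prop :=
  ∀ x y : X, ∃ γ : Geo X, γ 0 = x ∧ γ 1 = y

/-- Non-branching geodesic spaces. -/
structure IsNonBranching (X : Type u) [MetricSpace X] : Prop where
  geodesic : IsGeodesicSpace X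
  eq_of_eq : ∀ γ γ' : Geo X, γ 0 = γ' 0 →
    (∃ s : I, 0 < s ∧ s < 1 ∧ γ s = γ' s) → ∀ t : I, γ t = γ' t

/-- Strongly non-branching geodesic spaces. The quotient is written with extended distances, so
that the lower limit is taken in `[0,∞]`; its denominator is positive for `t > 0`. -/
structure IsStronglyNonBranching (X : Type u) [MetricSpace X] : Prop where
  geodesic : IsGeodesicSpace X
  liminf_pos : ∀ γ γ' : Geo X, γ 0 = γ' 0 → γ 1 ≠ γ' 1 → 0 < dist (γ 0) (γ 1) →
    0 < liminf (fun t : I => edist (γ t) (γ' t) / edist (γ 0) (γ t)) (𝓝[>] (0 : I))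

/-- Doubling measures, together with the convention that measures are finite on bounded sets. -/
structure IsDoublingMeasure {X : Type u} [MetricSpace X] [MeasurableSpace X]
    (m : Measure X) : Prop where
  finite_of_bounded : ∀ s : Set X, Bornology.IsBounded s → m s < ∞
  doubling : ∃ C : ℝ≥0, 0 < C ∧ ∀ (x : X) (r : ℝ), 0 < r →
    ENNReal.ofReal r < Metric.ediam (univ : Set X) →
    m (Metric.ball x (2 * r)) ≤ C * m (Metric.ball x r)

/-- The Gromov-Hausdorff distance, the infimum being over all isometric embeddings into a common
metric space. -/
noncomputable def ghDistance (A B : Type u) [MetricSpace A] [MetricSpace B] : ℝ≥0∞ :=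
  ⨅ (Z : Type u) (_ : MetricSpace Z) (f : A → Z) (_ : Isometry f) (g : B → Z) (_ : Isometry g),
    Metric.hausdorffEDist (range f) (range g)

/-- Pointed Gromov-Hausdorff convergence: for every `R > 0` the closed `R`-balls converge in the
Gromov-Hausdorff distance. -/
def PointedGHTendsto (A : ℕ → Type u) [∀ n, MetricSpace (A n)] (a : ∀ n, A n)
    (Y : Type u) [MetricSpace Y] (y : Y) : Prop :=
  ∀ R : ℝ, 0 < R →
    Tendsto (fun n => ghDistance (Metric.closedBall (a n) R) (Metric.closedBall y R))
      atTop (𝓝 0)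

/-- The set `X`, to be equipped with the distance `d_r = d / r`. -/
def Rescaled (X : Type u) (_r : Ioi (0 : ℝ)) : Type u := X

namespace Rescaled

variable {X : Type u}

/-- The point `x`, regarded as a point of the rescaled space. -/
def of (r : Ioi (0 : ℝ)) (x : X) : Rescaled X r := x

/-- The underlying point of `X`. -/
def out {r : Ioi (0 : ℝ)} (x : Rescaled X r) : X := x

/-- The distance `d_r(x,y) = d(x,y) / r`. -/
noncomputable instance [MetricSpace X] (r : Ioi (0 : ℝ)) : MetricSpace (Rescaled X r) where
  dist x y := (r : ℝ)⁻¹ * dist x.out y.out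
  dist_self x := by simp
  dist_comm x y := by simp only [dist_comm]
  dist_triangle x y z := by
    have h := mul_le_mul_of_nonneg_left (dist_triangle x.out y.out z.out)
      (inv_nonneg.2 (le_of_lt (mem_Ioi.1 r.2)))
    rwa [mul_add] at h
  eq_of_dist_eq_zero {x y} h := by
    have hr : (r : ℝ)⁻¹ ≠ 0 := inv_ne_zero (ne_of_gt (mem_Ioi.1 r.2))
    have h' : x.out = y.out := dist_eq_zero.1 ((mul_eq_zero.1 h).resolve_left hr)
    exact h'

end Rescaled

/-- `Y` is tangent to `X` at `x`: a pointed Gromov-Hausdorff limit of the spaces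
`(X, d_{r_n}, x)` for some sequence `r_n ↓ 0`. -/
def IsTangentAt (X : Type u) [MetricSpace X] (x : X) (Y : Type u) [MetricSpace Y] : Prop :=
  ∃ (r : ℕ → Ioi (0 : ℝ)) (y : Y), Antitone r ∧ Tendsto (fun n => (r n : ℝ)) atTop (𝓝 0) ∧
    PointedGHTendsto (fun n => Rescaled X (r n)) (fun n => Rescaled.of (r n) x) Y y

/-- `X` has at `x` a tangent space (complete and separable, as all metric spaces considered)
which is a non-branching geodesic space. -/
def HasNonBranchingTangentAt (X : Type u) [MetricSpace X] (x : X) : Prop :=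
  ∃ (Y : Type u) (_ : MetricSpace Y), CompleteSpace Y ∧ TopologicalSpace.SeparableSpace Y ∧
    IsTangentAt X x Y ∧ IsNonBranching Y

section Transport

variable {X : Type u} [MetricSpace X] [MeasurableSpace X]

/-- The transport plans between `μ` and `ν`. -/
def transportPlans (μ ν : Measure X) : Set (Measure (X × X)) :=
  {q | IsProbabilityMeasure q ∧ q.map Prod.fst = μ ∧ q.map Prod.snd = ν}

/-- The Wasserstein distance `W₂`, with values in `[0,∞]`. -/
noncomputable def W2 (μ ν : Measure X) : ℝ≥0∞ :=
  (⨅ q ∈ transportPlans μ ν, ∫⁻ p, edist p.1 p.2 ^ 2 ∂q) ^ (1 / 2 : ℝ)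

/-- The optimal geodesic plans between `μ` and `ν`. -/
structure IsOptimalGeodesicPlan (π : Measure (Geo X)) (μ ν : Measure X) : Prop where
  prob : IsProbabilityMeasure π
  map_zero : π.map (Geo.eval 0) = μ
  map_one : π.map (Geo.eval 1) = ν
  cost_eq : ∫⁻ γ, edist (γ 0) (γ 1) ^ 2 ∂π = W2 μ ν ^ 2
  cost_lt_top : W2 μ ν ^ 2 < ∞

/-- The integral `∫ f log f dm ∈ [-∞,∞]`, with `0 log 0 = 0`, i.e. the integral of the positive
part minus that of the negative part. It is `+∞` as soon as the integral of the positive part is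
infinite, so that an undefined `∞ - ∞` never counts as a bounded entropy. -/
noncomputable def entropyIntegral (m : Measure X) (f : X → ℝ≥0∞) : EReal :=
  open scoped Classical in
  if ∫⁻ x, ENNReal.ofReal ((f x).toReal * Real.log (f x).toReal) ∂m = ∞ then ⊤
  else
    ((∫⁻ x, ENNReal.ofReal ((f x).toReal * Real.log (f x).toReal) ∂m : ℝ≥0∞) : EReal) -
      ((∫⁻ x, ENNReal.ofReal (-((f x).toReal * Real.log (f x).toReal)) ∂m : ℝ≥0∞) : EReal)

end Transport

/-! The support `M` of the optimal plan is monotone for the squared distance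
(`dist_sq_add_le_of_mem_support`). Suppose that over `x` it contains two points `y ≠ y'`. Strong
non-branching makes geodesics `γ`, `γ'` towards them separate at a linear rate, so `x` lies in one
of countably many sets `branchSet`; almost every `x` is a density point of all those containing it.
Doubling then puts, within `o(s)` of `γ_s`, a point `z` of the same set, with its own separating
pair `α`, `α'` of nearly the same lengths.

Monotonicity compares `(x, y)` with `(z, α_1)`. As `d(z, y)` is at most `(1-s)ℓ + o(s)`, the first
order in `s` shows that `γ` and `γ'` have equal length `ℓ` (`le_of_forall_small_time`), and then
that going from `x` through `z` to `α_1`, or to `α'_1`, is minimizing up to `o(s)`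
(`exists_forall_small_time_le`). At scale `s` the points `x`, `z`, `α_s`, `α'_s` thus nearly form
two minimizing paths of length `2ℓ` with a common first half and distinct ends.
`IsTangentAt.exists_points` turns them into an exact configuration in the tangent space, which
`IsNonBranching.eq_of_dist_le` forbids. So `M` is almost everywhere single-valued, and Borel
selection gives the map. -/

/-! ### Doubling measures: positivity of balls and properness of the space. -/

namespace IsDoublingMeasure

variable {X : Type u} [MetricSpace X] [MeasurableSpace X] {m : Measure X}

/-- The factor `3/2` removes the restriction to radii below the diameter: either doubling applies at
radius `3/4 * r`, or the diameter is at most `3/4 * r` and the open ball of radius `r` is already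
the whole space. -/
lemma exists_measure_ball_pow_le (hm : IsDoublingMeasure m) :
    ∃ C : ℝ≥0, 0 < C ∧ ∀ (k : ℕ) (x : X) (r : ℝ), 0 < r →
      m (Metric.ball x ((3 / 2) ^ k * r)) ≤ (C : ℝ≥0∞) ^ k * m (Metric.ball x r) := by
  obtain ⟨C, -, hC⟩ := hm.doubling
  refine ⟨max C 1, by positivity, fun k x r hr => ?_⟩
  induction k with
  | zero => simp
  | succ k ih =>
    have hk : 0 < (3 / 2 : ℝ) ^ k * r := by positivity
    suffices h : ∀ r : ℝ, 0 < r →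
        m (Metric.ball x (3 / 2 * r)) ≤ (max C 1 : ℝ≥0) * m (Metric.ball x r) by
      calc m (Metric.ball x ((3 / 2) ^ (k + 1) * r))
          = m (Metric.ball x (3 / 2 * ((3 / 2) ^ k * r))) := by rw [pow_succ']; ring_nf
        _ ≤ (max C 1 : ℝ≥0) * m (Metric.ball x ((3 / 2) ^ k * r)) := h _ hk
        _ ≤ (max C 1 : ℝ≥0) * (((max C 1 : ℝ≥0) : ℝ≥0∞) ^ k * m (Metric.ball x r)) := by gcongr
        _ = _ := by rw [pow_succ', mul_assoc]
    intro r hr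
    by_cases hd : ENNReal.ofReal (3 / 4 * r) < Metric.ediam (univ : Set X)
    · have h := hC x (3 / 4 * r) (by positivity) hd
      calc m (Metric.ball x (3 / 2 * r)) = m (Metric.ball x (2 * (3 / 4 * r))) := by ring_nf
        _ ≤ C * m (Metric.ball x (3 / 4 * r)) := h
        _ ≤ (max C 1 : ℝ≥0) * m (Metric.ball x r) := by
          gcongr
          · exact le_max_left _ _
          · linarith
    · have huniv : Metric.ball x r = univ := by
        refine eq_univ_of_forall fun y => ?_
        have h : edist y x ≤ ENNReal.ofReal (3 / 4 * r) :=
          (Metric.edist_le_ediam_of_mem (mem_univ y) (mem_univ x)).trans (not_lt.1 hd)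
        rw [edist_dist, ENNReal.ofReal_le_ofReal_iff (by positivity)] at h
        rw [Metric.mem_ball]
        linarith
      calc m (Metric.ball x (3 / 2 * r)) ≤ 1 * m (Metric.ball x r) := by
            rw [huniv, one_mul]; exact measure_mono (subset_univ _)
        _ ≤ _ := by
          gcongr
          exact_mod_cast le_max_right C 1

lemma isUnifLocDoublingMeasure (hm : IsDoublingMeasure m) : IsUnifLocDoublingMeasure m := by
  obtain ⟨C, -, hC⟩ := hm.exists_measure_ball_pow_le
  refine ⟨C ^ 2, ?_⟩
  filter_upwards [self_mem_nhdsWithin] with r hr x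
  have hr : 0 < r := hr
  calc m (Metric.closedBall x (2 * r)) ≤ m (Metric.ball x ((3 / 2) ^ 2 * r)) :=
        measure_mono (Metric.closedBall_subset_ball (by linarith))
    _ ≤ (C : ℝ≥0∞) ^ 2 * m (Metric.ball x r) := hC 2 x r hr
    _ ≤ _ := by
      push_cast
      gcongr
      exact Metric.ball_subset_closedBall

lemma isLocallyFiniteMeasure (hm : IsDoublingMeasure m) : IsLocallyFiniteMeasure m :=
  ⟨fun x => ⟨_, Metric.ball_mem_nhds x one_pos, hm.finite_of_bounded _ Metric.isBounded_ball⟩⟩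

lemma measure_ball_pos (hm : IsDoublingMeasure m) (h0 : m ≠ 0) (x : X) {r : ℝ} (hr : 0 < r) :
    0 < m (Metric.ball x r) := by
  obtain ⟨C, -, hC⟩ := hm.exists_measure_ball_pow_le
  refine pos_iff_ne_zero.2 fun h => h0 ?_
  have hcover : (univ : Set X) ⊆ ⋃ k : ℕ, Metric.ball x ((3 / 2) ^ k * r) := by
    intro y _
    obtain ⟨k, hk⟩ := pow_unbounded_of_one_lt (dist y x / r) (by norm_num : (1 : ℝ) < 3 / 2)
    exact mem_iUnion.2 ⟨k, by rwa [Metric.mem_ball, ← div_lt_iff₀ hr]⟩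
  rw [← Measure.measure_univ_eq_zero]
  refine measure_mono_null hcover (measure_iUnion_null fun k => ?_)
  simpa [h] using hC k x r hr

/-- A ball that is not totally bounded contains an infinite separated sequence, hence infinitely
many disjoint balls of measure bounded below inside a set of finite measure. -/
lemma properSpace [CompleteSpace X] [BorelSpace X] (hm : IsDoublingMeasure m) (h0 : m ≠ 0) :
    ProperSpace X := by
  obtain ⟨C, hC0, hC⟩ := hm.exists_measure_ball_pow_le
  refine ⟨fun x R => TotallyBounded.isCompact_of_isClosed ?_ Metric.isClosed_closedBall⟩
  refine Metric.totallyBounded_iff.2 fun ε hε => ?_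
  by_contra! hcon
  obtain ⟨f, hf, hsep⟩ := exists_seq_of_forall_finset_exists (fun y => y ∈ Metric.closedBall x R)
    (fun y z => ε ≤ dist z y) (fun s _ => by
      obtain ⟨z, hz, hzs⟩ := not_subset.1 (hcon s s.finite_toSet)
      refine ⟨z, hz, fun y hy => ?_⟩
      by_contra! h
      exact hzs (mem_biUnion hy h))
  obtain ⟨k, hk⟩ := pow_unbounded_of_one_lt ((1 + R) / (ε / 2)) (by norm_num : (1 : ℝ) < 3 / 2)
  rw [div_lt_iff₀ (by positivity)] at hk
  have hlow : ∀ n, m (Metric.ball x 1) / (C : ℝ≥0∞) ^ k ≤ m (Metric.ball (f n) (ε / 2)) := by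
    intro n
    refine ENNReal.div_le_of_le_mul' ((measure_mono (Metric.ball_subset_ball' ?_)).trans
      (hC k (f n) (ε / 2) (by positivity)))
    have := hf n
    rw [Metric.mem_closedBall'] at this
    linarith
  have hdisj : Pairwise (Function.onFun Disjoint fun n => Metric.ball (f n) (ε / 2)) := by
    have key : ∀ i j, i < j → Disjoint (Metric.ball (f i) (ε / 2)) (Metric.ball (f j) (ε / 2)) :=
      fun i j hij => Metric.ball_disjoint_ball (by
        have := hsep i j hij
        rw [dist_comm] at this
        linarith)
    intro i j hij
    rcases lt_or_gt_of_ne hij with h | h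
    · exact key i j h
    · exact (key j i h).symm
  have hpos : 0 < m (Metric.ball x 1) / (C : ℝ≥0∞) ^ k :=
    ENNReal.div_pos (hm.measure_ball_pos h0 x one_pos).ne' (by finiteness)
  have hfin := Measure.finite_const_le_meas_of_disjoint_iUnion m hpos
    (fun n => Metric.isOpen_ball.measurableSet) hdisj (ne_of_lt (lt_of_le_of_lt (measure_mono
      (iUnion_subset fun n => Metric.ball_subset_closedBall.trans
        (Metric.closedBall_subset_closedBall' (y := x) (ε₂ := ε / 2 + R)
          (by have := hf n; rw [Metric.mem_closedBall] at this; linarith))))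
      (hm.finite_of_bounded _ Metric.isBounded_closedBall)))
  exact infinite_univ (hfin.subset fun n _ => hlow n)

end IsDoublingMeasure

/-! ### Monotonicity of optimal plans. -/

section Swap

variable {X : Type u} [MetricSpace X] [TopologicalSpace.SeparableSpace X] [MeasurableSpace X]
  [BorelSpace X]

/-- The competitor obtained from a plan `q = τ + t (P₁ + P₂)`, where `P₁`, `P₂` are the marginals of
`P`, by exchanging the end points of the pairs distributed according to `P`. -/
lemma lintegral_le_of_swap {μ ν : Measure X} [IsProbabilityMeasure μ] {q τ : Measure (X × X)}
    {P : Measure ((X × X) × (X × X))} {t : ℝ≥0∞}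
    (hq : q ∈ transportPlans μ ν) (hτ : q = τ + t • (P.map Prod.fst + P.map Prod.snd)) :
    (⨅ q ∈ transportPlans μ ν, ∫⁻ p, edist p.1 p.2 ^ 2 ∂q) ≤
      ∫⁻ p, edist p.1 p.2 ^ 2 ∂τ +
        t * ∫⁻ w, (edist w.1.1 w.2.2 ^ 2 + edist w.2.1 w.1.2 ^ 2) ∂P := by
  have : SecondCountableTopology X := UniformSpace.secondCountable_of_separable X
  have hc : Measurable fun p : X × X => edist p.1 p.2 ^ 2 := by fun_prop
  have h1 : Measurable fun w : (X × X) × (X × X) => (w.1.1, w.2.2) := by fun_prop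
  have h2 : Measurable fun w : (X × X) × (X × X) => (w.2.1, w.1.2) := by fun_prop
  set θ : Measure (X × X) := τ + t • (P.map (fun w => (w.1.1, w.2.2)) +
    P.map (fun w => (w.2.1, w.1.2))) with hθ
  have hfst : θ.map Prod.fst = μ := by
    rw [← hq.2.1, hτ, hθ]
    simp only [Measure.map_add _ _ measurable_fst, Measure.map_smul,
      Measure.map_map measurable_fst h1, Measure.map_map measurable_fst h2,
      Measure.map_map measurable_fst measurable_fst, Measure.map_map measurable_fst measurable_snd]
    rfl
  have hsnd : θ.map Prod.snd = ν := by
    rw [← hq.2.2, hτ, hθ]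
    simp only [Measure.map_add _ _ measurable_snd, Measure.map_smul,
      Measure.map_map measurable_snd h1, Measure.map_map measurable_snd h2,
      Measure.map_map measurable_snd measurable_fst, Measure.map_map measurable_snd measurable_snd]
    rw [add_comm (P.map _)]
    rfl
  have hprob : IsProbabilityMeasure θ := by
    constructor
    have := measure_univ (μ := μ)
    rwa [← hfst, Measure.map_apply measurable_fst MeasurableSet.univ] at this
  refine (iInf₂_le θ ⟨hprob, hfst, hsnd⟩).trans (le_of_eq ?_)
  rw [hθ, lintegral_add_measure, lintegral_smul_measure, lintegral_add_measure,
    lintegral_map hc h1, lintegral_map hc h2, ← lintegral_add_left (by fun_prop), smul_eq_mul]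

/-- The support of an optimal plan is monotone for the squared distance. -/
lemma dist_sq_add_le_of_mem_support {μ ν : Measure X} [IsProbabilityMeasure μ]
    {q : Measure (X × X)} (hq : q ∈ transportPlans μ ν)
    (hopt : ∫⁻ p, edist p.1 p.2 ^ 2 ∂q = ⨅ q ∈ transportPlans μ ν, ∫⁻ p, edist p.1 p.2 ^ 2 ∂q)
    (hfin : ∫⁻ p, edist p.1 p.2 ^ 2 ∂q ≠ ∞) {a b : X × X}
    (ha : a ∈ q.support) (hb : b ∈ q.support) :
    dist a.1 a.2 ^ 2 + dist b.1 b.2 ^ 2 ≤ dist a.1 b.2 ^ 2 + dist b.1 a.2 ^ 2 := by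
  have : SecondCountableTopology X := UniformSpace.secondCountable_of_separable X
  have := hq.1
  by_contra! hlt
  set F : (X × X) × (X × X) → ℝ := fun w =>
    dist w.1.1 w.1.2 ^ 2 + dist w.2.1 w.2.2 ^ 2 -
      (dist w.1.1 w.2.2 ^ 2 + dist w.2.1 w.1.2 ^ 2) with hF
  have hFc : Continuous F := by fun_prop
  obtain ⟨δ, hδ, hδF⟩ : ∃ δ > 0, δ < F (a, b) := exists_between (sub_pos.2 hlt)
  obtain ⟨U, V, hU, hV, haU, hbV, hUV⟩ :=
    isOpen_prod_iff.1 (isOpen_Ioi.preimage hFc : IsOpen (F ⁻¹' Ioi δ)) a b hδF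
  have hqU : q U ≠ 0 :=
    ((Measure.mem_support_iff_forall a).1 ha U (hU.mem_nhds haU)).ne'
  have hqV : q V ≠ 0 :=
    ((Measure.mem_support_iff_forall b).1 hb V (hV.mem_nhds hbV)).ne'
  -- Swapping end points gains at least `δ` on `U ×ˢ V`. Each marginal of `P` is at most `q`, since
  -- `q` has mass one, so half their sum can be removed from `q`.
  set P : Measure ((X × X) × (X × X)) := (q.restrict U).prod (q.restrict V) with hP
  set t : ℝ≥0∞ := 1 / 2 with ht
  have hmapfst : P.map Prod.fst = q V • q.restrict U := by
    rw [hP, Measure.map_fst_prod, Measure.restrict_apply_univ]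
  have hmapsnd : P.map Prod.snd = q U • q.restrict V := by
    rw [hP, Measure.map_snd_prod, Measure.restrict_apply_univ]
  have hle : t • (P.map Prod.fst + P.map Prod.snd) ≤ q := by
    have key : ∀ (U V : Set (X × X)), q V • q.restrict U ≤ q := fun U V => by
      refine Measure.le_iff.2 fun s _ => ?_
      rw [Measure.smul_apply, smul_eq_mul]
      calc q V * q.restrict U s ≤ 1 * q s := by
            gcongr
            · exact prob_le_one
            · exact Measure.restrict_le_self
        _ = q s := one_mul _
    rw [hmapfst, hmapsnd]
    refine Measure.le_iff.2 fun s _ => ?_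
    rw [Measure.smul_apply, Measure.add_apply, smul_eq_mul, ht]
    calc 1 / 2 * ((q V • q.restrict U) s + (q U • q.restrict V) s)
        ≤ 1 / 2 * (q s + q s) := by
          gcongr
          · exact key U V
          · exact key V U
      _ = q s := by
        rw [← two_mul, ← mul_assoc, one_div, ENNReal.inv_mul_cancel (by simp) (by simp), one_mul]
  have : IsFiniteMeasure (t • (P.map Prod.fst + P.map Prod.snd)) := isFiniteMeasure_of_le q hle
  have hτ := (Measure.sub_add_cancel_of_le hle).symm
  set τ := q - t • (P.map Prod.fst + P.map Prod.snd) with hτdef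
  have hswap := lintegral_le_of_swap hq hτ
  have hc : Measurable fun p : X × X => edist p.1 p.2 ^ 2 := by fun_prop
  have hcost : ∫⁻ p, edist p.1 p.2 ^ 2 ∂q = ∫⁻ p, edist p.1 p.2 ^ 2 ∂τ +
      t * ∫⁻ w, (edist w.1.1 w.1.2 ^ 2 + edist w.2.1 w.2.2 ^ 2) ∂P := by
    conv_lhs => rw [hτ]
    rw [lintegral_add_measure, lintegral_smul_measure, lintegral_add_measure,
      lintegral_map hc measurable_fst, lintegral_map hc measurable_snd,
      ← lintegral_add_left (by fun_prop), smul_eq_mul]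
  have hPuniv : P univ = q U * q V := by
    rw [hP, ← univ_prod_univ, Measure.prod_prod, Measure.restrict_apply_univ,
      Measure.restrict_apply_univ]
  have hgain : ∫⁻ w, (edist w.1.1 w.2.2 ^ 2 + edist w.2.1 w.1.2 ^ 2) ∂P +
      ENNReal.ofReal δ * (q U * q V) ≤
      ∫⁻ w, (edist w.1.1 w.1.2 ^ 2 + edist w.2.1 w.2.2 ^ 2) ∂P := by
    rw [← hPuniv, ← lintegral_const, ← lintegral_add_right _ measurable_const]
    refine lintegral_mono_ae ?_
    have hmem : ∀ᵐ w ∂P, w ∈ U ×ˢ V := by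
      rw [hP, Measure.prod_restrict]
      exact ae_restrict_mem (hU.prod hV).measurableSet
    filter_upwards [hmem] with w hw
    have hw' : δ < F w := hUV hw
    simp only [edist_dist]
    rw [← ENNReal.ofReal_pow dist_nonneg, ← ENNReal.ofReal_pow dist_nonneg,
      ← ENNReal.ofReal_pow dist_nonneg, ← ENNReal.ofReal_pow dist_nonneg,
      ← ENNReal.ofReal_add (by positivity) (by positivity),
      ← ENNReal.ofReal_add (by positivity) hδ.le,
      ← ENNReal.ofReal_add (by positivity) (by positivity)]
    refine ENNReal.ofReal_le_ofReal ?_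
    simp only [hF] at hw'
    linarith
  have hpos : t * (ENNReal.ofReal δ * (q U * q V)) ≠ 0 := by
    simp [ht, hqU, hqV, hδ]
  have : ∫⁻ p, edist p.1 p.2 ^ 2 ∂q + t * (ENNReal.ofReal δ * (q U * q V)) ≤
      ∫⁻ p, edist p.1 p.2 ^ 2 ∂q := by
    calc _ ≤ ∫⁻ p, edist p.1 p.2 ^ 2 ∂τ + t * ∫⁻ w, (edist w.1.1 w.2.2 ^ 2 +
            edist w.2.1 w.1.2 ^ 2) ∂P + t * (ENNReal.ofReal δ * (q U * q V)) :=
          add_le_add_left (hopt.trans_le hswap) _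
      _ = ∫⁻ p, edist p.1 p.2 ^ 2 ∂τ + t * (∫⁻ w, (edist w.1.1 w.2.2 ^ 2 +
            edist w.2.1 w.1.2 ^ 2) ∂P + ENNReal.ofReal δ * (q U * q V)) := by
          rw [mul_add, add_assoc]
      _ ≤ _ := by
          rw [hcost]
          gcongr
  exact (ENNReal.lt_add_right hfin hpos).not_ge this

end Swap

/-! ### Geodesics, concatenation and non-branching. -/

namespace Geo

variable {X : Type u} [MetricSpace X]

/-- The point of `γ` at a real time, times outside `[0,1]` being projected. -/
noncomputable def point (γ : Geo X) (s : ℝ) : X := γ (projIcc 0 1 zero_le_one s)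

lemma point_coe (γ : Geo X) (t : I) : γ.point t = γ t := by
  rw [point, projIcc_val]

@[simp] lemma point_zero (γ : Geo X) : γ.point 0 = γ 0 := γ.point_coe 0

@[simp] lemma point_one (γ : Geo X) : γ.point 1 = γ 1 := γ.point_coe 1

lemma dist_point (γ : Geo X) {s t : ℝ} (hs : s ∈ Icc (0 : ℝ) 1) (ht : t ∈ Icc (0 : ℝ) 1) :
    dist (γ.point s) (γ.point t) = |t - s| * dist (γ 0) (γ 1) := by
  have h := γ.dist_eq ⟨s, hs⟩ ⟨t, ht⟩
  rwa [← point_coe, ← point_coe] at h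

lemma dist_zero_point (γ : Geo X) {s : ℝ} (hs : s ∈ Icc (0 : ℝ) 1) :
    dist (γ 0) (γ.point s) = s * dist (γ 0) (γ 1) := by
  rw [← point_zero, γ.dist_point ⟨le_rfl, zero_le_one⟩ hs, sub_zero, abs_of_nonneg hs.1, point_zero]

lemma dist_point_one (γ : Geo X) {s : ℝ} (hs : s ∈ Icc (0 : ℝ) 1) :
    dist (γ.point s) (γ 1) = (1 - s) * dist (γ 0) (γ 1) := by
  rw [← point_one, γ.dist_point hs ⟨zero_le_one, le_rfl⟩, abs_of_nonneg (sub_nonneg.2 hs.2),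
    point_one]

/-- A map from `[0,1]` that is Lipschitz with constant the distance of its end points is a constant
speed geodesic. -/
noncomputable def ofLipschitz (f : I → X)
    (hf : ∀ s t : I, dist (f s) (f t) ≤ |(t : ℝ) - s| * dist (f 0) (f 1)) : Geo X where
  toMap := ⟨f, (LipschitzWith.of_dist_le_mul (K := ⟨dist (f 0) (f 1), dist_nonneg⟩)
    fun s t => (hf s t).trans_eq (by
      rw [mul_comm, Subtype.dist_eq, Real.dist_eq, abs_sub_comm]; rfl)).continuous⟩
  dist_eq := by
    -- A strict inequality between `s` and `t` would make the path through `0, s, t, 1` shorter than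
    -- the distance of its end points.
    have key : ∀ s t : I, s ≤ t → dist (f s) (f t) = |(t : ℝ) - s| * dist (f 0) (f 1) := by
      intro s t hst
      refine le_antisymm (hf s t) ?_
      have hst' : (s : ℝ) ≤ t := hst
      have h0 := hf 0 s
      have h1 := hf t 1
      have htri := dist_triangle4 (f 0) (f s) (f t) (f 1)
      rw [abs_of_nonneg (by simpa using s.2.1)] at h0
      rw [abs_of_nonneg (by simpa using t.2.2)] at h1
      rw [abs_of_nonneg (by linarith)]
      simp only [Icc.coe_zero, Icc.coe_one] at h0 h1
      linarith
    intro s t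
    rcases le_total s t with h | h
    · exact key s t h
    · have := key t s h
      rwa [dist_comm, abs_sub_comm] at this

/-- Concatenation of two geodesics of the same length whose union is length minimizing. -/
lemma exists_concat (α β : Geo X) (h : α 1 = β 0) {L : ℝ} (hα : dist (α 0) (α 1) = L)
    (hβ : dist (β 0) (β 1) = L) (hαβ : dist (α 0) (β 1) = 2 * L) :
    ∃ γ : Geo X, γ 0 = α 0 ∧ γ.point (1 / 2) = α 1 ∧ γ 1 = β 1 := by
  set f : I → X := fun t => if (t : ℝ) ≤ 1 / 2 then α.point (2 * t) else β.point (2 * t - 1) with hf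
  have f0 : f 0 = α 0 := by simp [hf]
  have f1 : f 1 = β 1 := by
    have : ¬ ((1 : ℝ) ≤ 1 / 2) := by norm_num
    simp only [hf, Icc.coe_one, if_neg this]
    norm_num
  have key : ∀ s t : I, s ≤ t → dist (f s) (f t) ≤ |(t : ℝ) - s| * dist (f 0) (f 1) := by
    intro s t hst
    have hst' : (s : ℝ) ≤ t := hst
    have hs := s.2
    have ht := t.2
    rw [f0, f1, hαβ, abs_of_nonneg (by linarith)]
    by_cases hs2 : (s : ℝ) ≤ 1 / 2 <;> by_cases ht2 : (t : ℝ) ≤ 1 / 2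
    · simp only [hf, if_pos hs2, if_pos ht2]
      rw [α.dist_point ⟨by linarith [hs.1], by linarith⟩ ⟨by linarith [ht.1], by linarith⟩, hα,
        abs_of_nonneg (by linarith)]
      linarith
    · simp only [hf, if_pos hs2, if_neg ht2]
      have htri := dist_triangle (α.point (2 * s)) (α 1) (β.point (2 * t - 1))
      have hs' := α.dist_point_one (s := 2 * s) ⟨by linarith [hs.1], by linarith⟩
      have ht' := β.dist_zero_point (s := 2 * t - 1) ⟨by linarith, by linarith [ht.2]⟩
      rw [hα] at hs'
      rw [hβ, ← h] at ht'
      linarith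
    · linarith
    · simp only [hf, if_neg hs2, if_neg ht2]
      rw [β.dist_point ⟨by linarith, by linarith [hs.2]⟩ ⟨by linarith, by linarith [ht.2]⟩, hβ,
        abs_of_nonneg (by linarith)]
      linarith
  refine ⟨ofLipschitz f fun s t => ?_, f0, ?_, f1⟩
  · rcases le_total s t with hst | hst
    · exact key s t hst
    · have := key t s hst
      rwa [dist_comm, abs_sub_comm] at this
  · have hmem : (1 / 2 : ℝ) ∈ Icc (0 : ℝ) 1 := by constructor <;> norm_num
    rw [point, projIcc_of_mem _ hmem]
    change f ⟨1 / 2, hmem⟩ = _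
    simp [hf]

end Geo

/-- The triangle inequality turns all the bounds into equalities, so `q₁` is a midpoint of `q₀, q₂`
and of `q₀, q₃`. The two concatenated geodesics share their start and their value at time `1/2`. -/
lemma IsNonBranching.eq_of_dist_le {Y : Type u} [MetricSpace Y] (hY : IsNonBranching Y)
    {q₀ q₁ q₂ q₃ : Y} {L : ℝ} (h01 : dist q₀ q₁ ≤ L) (h12 : dist q₁ q₂ ≤ L) (h13 : dist q₁ q₃ ≤ L)
    (h02 : 2 * L ≤ dist q₀ q₂) (h03 : 2 * L ≤ dist q₀ q₃) : q₂ = q₃ := by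
  obtain ⟨α, rfl, rfl⟩ := hY.geodesic q₀ q₁
  obtain ⟨β, hβ0, rfl⟩ := hY.geodesic (α 1) q₂
  obtain ⟨β', hβ'0, rfl⟩ := hY.geodesic (α 1) q₃
  have t2 := dist_triangle (α 0) (α 1) (β 1)
  have t3 := dist_triangle (α 0) (α 1) (β' 1)
  obtain ⟨γ, γ0, γh, γ1⟩ := Geo.exists_concat α β hβ0.symm (L := L) (by linarith)
    (by rw [hβ0]; linarith) (by linarith)
  obtain ⟨γ', γ'0, γ'h, γ'1⟩ := Geo.exists_concat α β' hβ'0.symm (L := L) (by linarith)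
    (by rw [hβ'0]; linarith) (by linarith)
  rw [← γ1, ← γ'1]
  have hmem : (1 / 2 : ℝ) ∈ Icc (0 : ℝ) 1 := by constructor <;> norm_num
  refine hY.eq_of_eq γ γ' (γ0.trans γ'0.symm) ⟨⟨1 / 2, hmem⟩, ?_, ?_, ?_⟩ 1
  · rw [← Subtype.coe_lt_coe]; norm_num
  · rw [← Subtype.coe_lt_coe]; norm_num
  · rw [← Geo.point_coe, ← Geo.point_coe]
    exact γh.trans γ'h.symm

/-! ### Passing approximate configurations to a tangent space. -/

section GromovHausdorff

lemma exists_map_of_ghDistance_lt {A B : Type u} [MetricSpace A] [MetricSpace B] {δ : ℝ}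
    (h : ghDistance A B < ENNReal.ofReal δ) :
    (∃ φ : A → B, ∀ a a', |dist (φ a) (φ a') - dist a a'| ≤ 2 * δ) ∧
      ∃ ψ : B → A, ∀ b b', |dist (ψ b) (ψ b') - dist b b'| ≤ 2 * δ := by
  simp only [ghDistance, iInf_lt_iff] at h
  obtain ⟨Z, _, f, hf, g, hg, h⟩ := h
  have key : ∀ {A B : Type u} [MetricSpace A] [MetricSpace B] {f : A → Z} {g : B → Z},
      Isometry f → Isometry g → Metric.hausdorffEDist (range f) (range g) < ENNReal.ofReal δ →
      ∃ φ : A → B, ∀ a a', |dist (φ a) (φ a') - dist a a'| ≤ 2 * δ := by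
    intro A B _ _ f g hf hg h
    have hex : ∀ a : A, ∃ b : B, dist (f a) (g b) < δ := by
      intro a
      obtain ⟨_, ⟨b, rfl⟩, hb⟩ := Metric.exists_edist_lt_of_hausdorffEDist_lt (mem_range_self a) h
      refine ⟨b, ?_⟩
      rw [edist_dist] at hb
      exact (ENNReal.ofReal_lt_ofReal_iff_of_nonneg dist_nonneg).1 hb
    choose φ hφ using hex
    refine ⟨φ, fun a a' => ?_⟩
    rw [← hf.dist_eq, ← hg.dist_eq, ← Real.dist_eq]
    refine (dist_dist_dist_le _ _ _ _).trans ?_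
    have h1 := hφ a
    have h2 := hφ a'
    rw [dist_comm] at h1 h2
    linarith
  exact ⟨key hf hg h, key hg hf (by rwa [Metric.hausdorffEDist_comm])⟩

/-- A finite net of an approximating compact ball discretizes the limit ball: points sent near the
same net point are at distance below `ε/4 + ε/4` plus the distortion `2 * (ε/8)`. -/
lemma PointedGHTendsto.isCompact_closedBall {A : ℕ → Type u} [∀ n, MetricSpace (A n)]
    {a : ∀ n, A n} {Y : Type u} [MetricSpace Y] [CompleteSpace Y] {y : Y}
    (h : PointedGHTendsto A a Y y) (hA : ∀ n R, IsCompact (Metric.closedBall (a n) R))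
    {R : ℝ} (hR : 0 < R) : IsCompact (Metric.closedBall y R) := by
  refine TotallyBounded.isCompact_of_isClosed ?_ Metric.isClosed_closedBall
  refine Metric.totallyBounded_of_finite_discretization fun ε hε => ?_
  obtain ⟨n, hn⟩ := ((h R hR).eventually_lt_const
    (ENNReal.ofReal_pos.2 (by positivity : 0 < ε / 8))).exists
  obtain ⟨-, ψ, hψ⟩ := exists_map_of_ghDistance_lt hn
  have : CompactSpace (Metric.closedBall (a n) R) := isCompact_iff_compactSpace.1 (hA n R)
  obtain ⟨t, ht, hcov⟩ := Metric.totallyBounded_iff.1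
    (isCompact_univ (X := Metric.closedBall (a n) R)).totallyBounded (ε / 4) (by positivity)
  have hex : ∀ b : Metric.closedBall y R, ∃ c : t, dist (ψ b) c < ε / 4 := by
    intro b
    obtain ⟨c, hc, hbc⟩ := mem_iUnion₂.1 (hcov (mem_univ (ψ b)))
    exact ⟨⟨c, hc⟩, hbc⟩
  choose F hF using hex
  refine ⟨t, ht.fintype, F, fun b b' hbb' => ?_⟩
  have h1 := hF b
  have h2 := hF b'
  rw [← hbb'] at h2
  have h3 := dist_triangle_right (ψ b) (ψ b') (F b)
  have h4 := (abs_le.1 (hψ b b')).1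
  rw [← Subtype.dist_eq]
  linarith

lemma Rescaled.dist_of {X : Type u} [MetricSpace X] (r : Ioi (0 : ℝ)) (a b : X) :
    dist (Rescaled.of r a) (Rescaled.of r b) = (r : ℝ)⁻¹ * dist a b := rfl

lemma Rescaled.isCompact_closedBall {X : Type u} [MetricSpace X] [ProperSpace X]
    (r : Ioi (0 : ℝ)) (x : X) (R : ℝ) : IsCompact (Metric.closedBall (Rescaled.of r x) R) := by
  have hr : (0 : ℝ) < r := r.2
  have hcont : Continuous (Rescaled.of r : X → Rescaled X r) :=
    (LipschitzWith.of_dist_le_mul (K := ⟨(r : ℝ)⁻¹, by positivity⟩)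
      fun a b => (Rescaled.dist_of r a b).le).continuous
  convert (ProperSpace.isCompact_closedBall x (r * R)).image hcont using 1
  ext z
  constructor
  · intro hz
    refine ⟨z.out, ?_, rfl⟩
    rw [Metric.mem_closedBall, ← inv_mul_le_iff₀ hr]
    exact hz
  · rintro ⟨w, hw, rfl⟩
    rwa [Metric.mem_closedBall, ← inv_mul_le_iff₀ hr] at hw

/-- Approximate configurations of four points at small scales around `x` produce an exact one in
each tangent space at `x`. -/
lemma IsTangentAt.exists_points {X Y : Type u} [MetricSpace X] [ProperSpace X] [MetricSpace Y]
    [CompleteSpace Y] {x : X} (hY : IsTangentAt X x Y) {L c : ℝ} (hL : 0 < L)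
    (h : ∀ η > 0, ∀ᶠ r in 𝓝[>] (0 : ℝ), ∃ p₁ p₂ p₃ : X, dist x p₁ ≤ (L + η) * r ∧
      dist p₁ p₂ ≤ (L + η) * r ∧ dist p₁ p₃ ≤ (L + η) * r ∧ (2 * L - η) * r ≤ dist x p₂ ∧
      (2 * L - η) * r ≤ dist x p₃ ∧ c * r ≤ dist p₂ p₃) :
    ∃ q₀ q₁ q₂ q₃ : Y, dist q₀ q₁ ≤ L ∧ dist q₁ q₂ ≤ L ∧ dist q₁ q₃ ≤ L ∧
      2 * L ≤ dist q₀ q₂ ∧ 2 * L ≤ dist q₀ q₃ ∧ c ≤ dist q₂ q₃ := by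
  obtain ⟨r, y, -, hr0, hGH⟩ := hY
  -- With errors at most one, all four rescaled points lie in the ball of radius `2 * L + 2`.
  have hR : 0 < 2 * L + 2 := by positivity
  have hK : IsCompact (Metric.closedBall y (2 * L + 2)) :=
    hGH.isCompact_closedBall (fun n R => Rescaled.isCompact_closedBall (r n) x R) hR
  set K := Metric.closedBall y (2 * L + 2) with hKdef
  -- `F` is the largest violation of the six inequalities. It attains its minimum on the compact
  -- `K⁴`, and approximate configurations bound this minimum by every `η > 0`: `η/2` from the
  -- configuration and `2 * (η/4)` from the distortion.
  set F : Y × Y × Y × Y → ℝ := fun q =>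
    max (max (dist q.1 q.2.1 - L) (max (dist q.2.1 q.2.2.1 - L) (dist q.2.1 q.2.2.2 - L)))
      (max (2 * L - dist q.1 q.2.2.1) (max (2 * L - dist q.1 q.2.2.2) (c - dist q.2.2.1 q.2.2.2)))
    with hF
  have hFc : Continuous F := by fun_prop
  have hyK : y ∈ K := Metric.mem_closedBall_self hR.le
  obtain ⟨q, hq, hmin⟩ := (hK.prod (hK.prod (hK.prod hK))).exists_isMinOn
    ⟨(y, y, y, y), hyK, hyK, hyK, hyK⟩ hFc.continuousOn
  have hq0 : F q ≤ 0 := by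
    refine le_of_forall_pos_le_add fun η hη => ?_
    rw [zero_add]
    have hrt : Tendsto (fun n => (r n : ℝ)) atTop (𝓝[>] 0) :=
      tendsto_nhdsWithin_iff.2 ⟨hr0, Eventually.of_forall fun n => (r n).2⟩
    obtain ⟨n, hn, p₁, p₂, p₃, h1, h2, h3, h4, h5, h6⟩ :=
      (((hGH _ hR).eventually_lt_const
        (ENNReal.ofReal_pos.2 (by positivity : 0 < η / 4))).and
        (hrt.eventually (h (min (η / 2) 1) (by positivity)))).exists
    have hrn : (0 : ℝ) < r n := (r n).2
    have hη1 : min (η / 2) 1 ≤ 1 := min_le_right _ _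
    have hη2 : min (η / 2) 1 ≤ η / 2 := min_le_left _ _
    have up : ∀ {a b : X} {d : ℝ}, dist a b ≤ d * r n →
        dist (Rescaled.of (r n) a) (Rescaled.of (r n) b) ≤ d := fun {a b d} hab => by
      rwa [Rescaled.dist_of, inv_mul_le_iff₀ hrn, mul_comm]
    have low : ∀ {a b : X} {d : ℝ}, d * r n ≤ dist a b →
        d ≤ dist (Rescaled.of (r n) a) (Rescaled.of (r n) b) := fun {a b d} hab => by
      rwa [Rescaled.dist_of, le_inv_mul_iff₀ hrn, mul_comm]
    obtain ⟨⟨φ, hφ⟩, -⟩ := exists_map_of_ghDistance_lt hn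
    have u1 := up h1
    have u2 := up h2
    have u3 := up h3
    have u4 := low h4
    have u5 := low h5
    have u6 := low h6
    set P₀ := Rescaled.of (r n) x
    set P₁ := Rescaled.of (r n) p₁
    set P₂ := Rescaled.of (r n) p₂
    set P₃ := Rescaled.of (r n) p₃
    have m0 : P₀ ∈ Metric.closedBall P₀ (2 * L + 2) := Metric.mem_closedBall_self hR.le
    have m1 : P₁ ∈ Metric.closedBall P₀ (2 * L + 2) := by
      rw [Metric.mem_closedBall']; linarith
    have m2 : P₂ ∈ Metric.closedBall P₀ (2 * L + 2) := by
      rw [Metric.mem_closedBall']; linarith [dist_triangle P₀ P₁ P₂]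
    have m3 : P₃ ∈ Metric.closedBall P₀ (2 * L + 2) := by
      rw [Metric.mem_closedBall']; linarith [dist_triangle P₀ P₁ P₃]
    have e : ∀ {a b : Rescaled X (r n)} (ha : a ∈ Metric.closedBall P₀ (2 * L + 2))
        (hb : b ∈ Metric.closedBall P₀ (2 * L + 2)),
        |dist (φ ⟨a, ha⟩ : Y) (φ ⟨b, hb⟩) - dist a b| ≤ η / 2 := fun ha hb => by
      have := hφ ⟨_, ha⟩ ⟨_, hb⟩
      rw [Subtype.dist_eq, Subtype.dist_eq] at this
      linarith
    have hle : F (φ ⟨P₀, m0⟩, φ ⟨P₁, m1⟩, φ ⟨P₂, m2⟩, φ ⟨P₃, m3⟩) ≤ η := by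
      have e1 := abs_le.1 (e m0 m1)
      have e2 := abs_le.1 (e m1 m2)
      have e3 := abs_le.1 (e m1 m3)
      have e4 := abs_le.1 (e m0 m2)
      have e5 := abs_le.1 (e m0 m3)
      have e6 := abs_le.1 (e m2 m3)
      simp only [hF, max_le_iff]
      refine ⟨⟨?_, ?_, ?_⟩, ?_, ?_, ?_⟩ <;> linarith
    exact (isMinOn_iff.1 hmin _ ⟨(φ _).2, (φ _).2, (φ _).2, (φ _).2⟩).trans hle
  simp only [hF, max_le_iff, sub_nonpos] at hq0
  exact ⟨q.1, q.2.1, q.2.2.1, q.2.2.2, hq0.1.1, hq0.1.2.1, hq0.1.2.2, hq0.2.1, hq0.2.2.1,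
    hq0.2.2.2⟩

end GromovHausdorff

/-! ### First-order consequences of monotonicity for lengths. -/

section Lengths

/-- Here `A` stands for `d(γ_0, α_1)` and `l'` for the length of `α`, where `α` starts near `γ_s`.
The terms of order zero in `s` cancel; dividing by `s` and letting `ε → 0` leaves `2ℓ² ≤ 2lℓ`. -/
lemma le_of_forall_small_time {ℓ l : ℝ} (hℓ : 0 < ℓ)
    (h : ∀ ε > 0, ε ≤ 1 → ∃ s l' A : ℝ, 0 < s ∧ s ≤ ε ∧ |l' - l| ≤ ε ∧ 0 ≤ A ∧
      A ≤ s * (ℓ + ε) + l' ∧ ℓ ^ 2 + l' ^ 2 ≤ A ^ 2 + ((1 - s) * ℓ + ε * s) ^ 2) : ℓ ≤ l := by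
  have key : ∀ ε > 0, ε ≤ 1 →
      2 * ℓ * (ℓ - ε) ≤ 2 * (l + ε) * (ℓ + ε) + ε * ((ℓ + ε) ^ 2 + (ℓ - ε) ^ 2) := by
    intro ε hε hε1
    obtain ⟨s, l', A, hs, hsε, hl', hA, hAle, hle⟩ := h ε hε hε1
    have hA2 : A ^ 2 ≤ (s * (ℓ + ε) + l') ^ 2 := pow_le_pow_left₀ hA hAle 2
    have h1 : s * (2 * ℓ * (ℓ - ε)) ≤
        s * (2 * l' * (ℓ + ε) + s * ((ℓ + ε) ^ 2 + (ℓ - ε) ^ 2)) := by linarith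
    have h2 := le_of_mul_le_mul_left h1 hs
    have h3 : l' * (ℓ + ε) ≤ (l + ε) * (ℓ + ε) := by
      gcongr
      linarith [(abs_le.1 hl').2]
    have h4 : s * ((ℓ + ε) ^ 2 + (ℓ - ε) ^ 2) ≤ ε * ((ℓ + ε) ^ 2 + (ℓ - ε) ^ 2) := by gcongr
    linarith
  have hlim : 2 * ℓ * (ℓ - 0) ≤ 2 * (l + 0) * (ℓ + 0) + 0 * ((ℓ + 0) ^ 2 + (ℓ - 0) ^ 2) := by
    have c1 : Continuous fun ε : ℝ => 2 * ℓ * (ℓ - ε) := by fun_prop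
    have c2 : Continuous fun ε : ℝ =>
      2 * (l + ε) * (ℓ + ε) + ε * ((ℓ + ε) ^ 2 + (ℓ - ε) ^ 2) := by fun_prop
    refine le_of_tendsto_of_tendsto (b := 𝓝[>] (0 : ℝ)) (c1.tendsto 0 |>.mono_left
      nhdsWithin_le_nhds) (c2.tendsto 0 |>.mono_left nhdsWithin_le_nhds) ?_
    filter_upwards [Ioc_mem_nhdsGT one_pos] with ε hε using key ε hε.1 hε.2
  nlinarith

/-- The same inequality bounds `(A - l') * (A + l')` below by about `2sℓ²`. Since `A + l'` is at
most about `2ℓ`, the factor `A - l'` is at least `s * (ℓ - η)`. -/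
lemma exists_forall_small_time_le {ℓ η : ℝ} (hη : 0 < η) (hηℓ : η < ℓ) :
    ∃ ε > 0, ε ≤ η ∧ ∀ s l' A : ℝ, 0 < s → s ≤ ε → |l' - ℓ| ≤ ε → 0 ≤ l' → 0 ≤ A →
      A ≤ s * (ℓ + ε) + l' → ℓ ^ 2 + l' ^ 2 ≤ A ^ 2 + ((1 - s) * ℓ + ε * s) ^ 2 →
      l' + s * (ℓ - η) ≤ A := by
  have hℓ : 0 < ℓ := hη.trans hηℓ
  have c1 : Continuous fun ε : ℝ =>
    2 * ℓ * (ℓ - ε) - ε * (ℓ - ε) ^ 2 - (ℓ - η) * (2 * ℓ + 2 * ε + ε * (ℓ + ε)) := by fun_prop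
  have hev : ∀ᶠ ε in 𝓝[>] (0 : ℝ), 0 <
      2 * ℓ * (ℓ - ε) - ε * (ℓ - ε) ^ 2 - (ℓ - η) * (2 * ℓ + 2 * ε + ε * (ℓ + ε)) := by
    refine ((c1.tendsto 0).mono_left nhdsWithin_le_nhds).eventually_const_lt ?_
    have : 0 < ℓ * η := by positivity
    nlinarith
  obtain ⟨ε, hε, hε0, hεη⟩ := (hev.and (Ioc_mem_nhdsGT hη)).exists
  refine ⟨ε, hε0, hεη, fun s l' A hs hsε hl' hl0 hA hAle hle => ?_⟩
  have hpos : 0 < ℓ - η := sub_pos.2 hηℓ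
  by_contra! hlt
  have h1 : A + l' ≤ 2 * ℓ + 2 * ε + ε * (ℓ + ε) := by
    have : s * (ℓ + ε) ≤ ε * (ℓ + ε) := by gcongr
    linarith [(abs_le.1 hl').2]
  have h2 : (A - l') * (A + l') ≤ s * (ℓ - η) * (2 * ℓ + 2 * ε + ε * (ℓ + ε)) := by
    have h3 : (A - l') * (A + l') ≤ s * (ℓ - η) * (A + l') := by
      gcongr
      linarith
    have h4 : s * (ℓ - η) * (A + l') ≤ s * (ℓ - η) * (2 * ℓ + 2 * ε + ε * (ℓ + ε)) := by
      gcongr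
    linarith
  have h5 : s * (2 * ℓ * (ℓ - ε) - s * (ℓ - ε) ^ 2) ≤ (A - l') * (A + l') := by linarith
  have h6 : s * (s * (ℓ - ε) ^ 2) ≤ s * (ε * (ℓ - ε) ^ 2) := by gcongr
  have h7 := mul_pos hs hε
  linarith

end Lengths

/-! ### Blow-up of a monotone set at density points. -/

section Monotone

variable {X : Type u} [MetricSpace X]

/-- Monotonicity of a set of pairs of points for the squared distance cost. -/
def IsDistSqMonotone (M : Set (X × X)) : Prop :=
  ∀ a ∈ M, ∀ b ∈ M,
    dist a.1 a.2 ^ 2 + dist b.1 b.2 ^ 2 ≤ dist a.1 b.2 ^ 2 + dist b.1 a.2 ^ 2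

/-- Both bounds are triangle inequalities through `γ.point s`; the second is inserted into the
monotonicity inequality. -/
lemma IsDistSqMonotone.dist_estimates {M : Set (X × X)} (hM : IsDistSqMonotone M) {γ α : Geo X}
    (hγ : (γ 0, γ 1) ∈ M) (hα : (α 0, α 1) ∈ M) {s ε : ℝ} (hs : s ∈ Icc (0 : ℝ) 1)
    (hd : dist (α 0) (γ.point s) ≤ ε * s) :
    dist (γ 0) (α 1) ≤ s * (dist (γ 0) (γ 1) + ε) + dist (α 0) (α 1) ∧
      dist (γ 0) (γ 1) ^ 2 + dist (α 0) (α 1) ^ 2 ≤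
        dist (γ 0) (α 1) ^ 2 + ((1 - s) * dist (γ 0) (γ 1) + ε * s) ^ 2 := by
  have h1 := dist_triangle4 (γ 0) (γ.point s) (α 0) (α 1)
  rw [γ.dist_zero_point hs, dist_comm (γ.point s)] at h1
  have h2 := dist_triangle (α 0) (γ.point s) (γ 1)
  rw [γ.dist_point_one hs] at h2
  refine ⟨by linarith, (hM _ hγ _ hα).trans ?_⟩
  gcongr
  linarith

/-- The starting points of two geodesics with end points in `M`, with lengths in given intervals,
that separate at a definite linear rate. -/
def branchSet (M : Set (X × X)) (k : ℕ) (a b a' b' : ℚ) : Set X :=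
  {x | ∃ γ γ' : Geo X, γ 0 = x ∧ γ' 0 = x ∧ (x, γ 1) ∈ M ∧ (x, γ' 1) ∈ M ∧
    dist (γ 0) (γ 1) ∈ Ioo (a : ℝ) b ∧ dist (γ' 0) (γ' 1) ∈ Ioo (a' : ℝ) b' ∧
    ∀ s ∈ Icc (0 : ℝ) (1 / (k + 1)), 1 / (k + 1) * s ≤ dist (γ.point s) (γ'.point s)}

/-- Every geodesic from `x` is tangent to `E` at `x`. -/
def IsGeodesicallyDense (E : Set X) (x : X) : Prop :=
  ∀ γ : Geo X, γ 0 = x → ∀ ε > 0, ∀ᶠ s in 𝓝[>] (0 : ℝ), ∃ z ∈ E, dist z (γ.point s) ≤ ε * s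

/-- The Lebesgue density theorem for doubling measures allows balls whose centres stay within `K`
radii of `x`. The balls of radius `ε * s` about `γ_s` are of this kind once `K` is at least the
length of `γ` divided by `ε`. -/
lemma IsDoublingMeasure.ae_isGeodesicallyDense [TopologicalSpace.SeparableSpace X]
    [MeasurableSpace X] [BorelSpace X] {m : Measure X} (hm : IsDoublingMeasure m) (E : Set X) :
    ∀ᵐ x ∂m, x ∈ E → IsGeodesicallyDense E x := by
  have : SecondCountableTopology X := UniformSpace.secondCountable_of_separable X
  have := hm.isUnifLocDoublingMeasure
  have := hm.isLocallyFiniteMeasure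
  have hdens := ae_all_iff.2 fun K : ℕ =>
    IsUnifLocDoublingMeasure.ae_tendsto_measure_inter_div.{u, 0} m E K
  -- This inequality holds for arbitrary `E`, so no measurability of the branch sets is needed.
  have hnull := Measure.le_restrict_apply (μ := m) E _ |>.trans_eq (ae_iff.1 hdens)
  refine measure_mono_null ?_ (nonpos_iff_eq_zero.1 hnull)
  intro x hx
  obtain ⟨hxE, hx⟩ := Classical.not_imp.1 hx
  refine ⟨fun hall => hx ?_, hxE⟩
  intro γ hγ ε hε
  obtain ⟨K, hK⟩ := exists_nat_ge (dist (γ 0) (γ 1) / ε)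
  rw [div_le_iff₀ hε] at hK
  have hδ : Tendsto (fun s : ℝ => ε * s) (𝓝[>] 0) (𝓝[>] 0) := by
    refine tendsto_nhdsWithin_iff.2 ⟨?_, ?_⟩
    · have : Tendsto (fun s : ℝ => ε * s) (𝓝 0) (𝓝 (ε * 0)) :=
        (continuous_const.mul continuous_id).tendsto 0
      rw [mul_zero] at this
      exact this.mono_left nhdsWithin_le_nhds
    · filter_upwards [self_mem_nhdsWithin] with s hs using mul_pos hε hs
  have hlim := hall K γ.point (fun s => ε * s) hδ (by
    filter_upwards [Ioc_mem_nhdsGT one_pos] with s hs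
    rw [Metric.mem_closedBall, ← hγ, γ.dist_zero_point ⟨hs.1.le, hs.2⟩]
    nlinarith [hs.1])
  filter_upwards [hlim.eventually_const_lt zero_lt_one] with s hs
  have hne : (E ∩ Metric.closedBall (γ.point s) (ε * s)).Nonempty := by
    rw [nonempty_iff_ne_empty]
    rintro h
    simp [h] at hs
  exact hne

lemma IsStronglyNonBranching.exists_separation (hX : IsStronglyNonBranching X) {γ γ' : Geo X}
    (h0 : γ 0 = γ' 0) (h1 : γ 1 ≠ γ' 1) (hpos : 0 < dist (γ 0) (γ 1)) :
    ∃ k : ℕ, ∀ s ∈ Icc (0 : ℝ) (1 / (k + 1)), 1 / (k + 1) * s ≤ dist (γ.point s) (γ'.point s) := by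
  obtain ⟨c, hc0, hc⟩ := exists_between (hX.liminf_pos γ γ' h0 h1 hpos)
  have hctop : c ≠ ∞ := (hc.trans_le le_top).ne
  have hcpos : 0 < c.toReal := ENNReal.toReal_pos hc0.ne' hctop
  obtain ⟨u, hu, hsub⟩ := (mem_nhdsGT_iff_exists_Ioo_subset' (zero_lt_one : (0 : I) < 1)).1
    (eventually_lt_of_lt_liminf hc)
  have hu' : (0 : ℝ) < u := hu
  -- The same `1 / (k + 1)` bounds the time window and the separation rate.
  obtain ⟨k, hk⟩ := exists_nat_one_div_lt
    (lt_min hu' (mul_pos hcpos hpos))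
  refine ⟨k, fun s hs => ?_⟩
  rcases hs.1.eq_or_lt with rfl | hs0
  · simp
  have hsu : s < u := hs.2.trans_lt (hk.trans_le (min_le_left _ _))
  have hs1 : s ∈ Icc (0 : ℝ) 1 := ⟨hs.1, hsu.le.trans u.2.2⟩
  have hmem := hsub (show (⟨s, hs1⟩ : I) ∈ Ioo 0 u from ⟨hs0, hsu⟩)
  have hle := ENNReal.mul_le_of_le_div (le_of_lt (show c < _ from hmem))
  rw [← γ.point_coe ⟨s, hs1⟩, ← γ'.point_coe ⟨s, hs1⟩, edist_dist, edist_dist, γ.dist_zero_point hs1,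
    ← ENNReal.ofReal_toReal hctop, ← ENNReal.ofReal_mul hcpos.le,
    ENNReal.ofReal_le_ofReal_iff dist_nonneg] at hle
  have hk' := hk.le.trans (min_le_right _ _)
  calc 1 / ((k : ℝ) + 1) * s ≤ (c.toReal * dist (γ 0) (γ 1)) * s := by gcongr
    _ ≤ _ := by linarith

/-- At a point of geodesic density with a non-branching tangent space a monotone set is
single-valued. -/
lemma IsDistSqMonotone.eq_of_isGeodesicallyDense [ProperSpace X] (hX : IsStronglyNonBranching X)
    {M : Set (X × X)} (hM : IsDistSqMonotone M) {x y y' : X} (hy : (x, y) ∈ M) (hy' : (x, y') ∈ M)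
    (hdens : ∀ k a b a' b', x ∈ branchSet M k a b a' b' →
      IsGeodesicallyDense (branchSet M k a b a' b') x)
    (htan : HasNonBranchingTangentAt X x) : y = y' := by
  by_contra hne
  -- At most one of the distinct points `y`, `y'` equals `x`.
  wlog hxy : 0 < dist x y generalizing y y'
  · refine this hy' hy (Ne.symm hne) ?_
    rw [not_lt, dist_le_zero] at hxy
    rw [dist_pos, hxy]
    exact hne
  obtain ⟨γ, rfl, rfl⟩ := hX.geodesic x y
  obtain ⟨γ', h0, rfl⟩ := hX.geodesic (γ 0) y'
  obtain ⟨k, hk⟩ := hX.exists_separation h0.symm hne hxy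
  set ℓ := dist (γ 0) (γ 1) with hℓ
  set ℓ' := dist (γ' 0) (γ' 1) with hℓ'
  have hnear : ∀ g : Geo X, g 0 = γ 0 → ∀ η > 0, ∀ᶠ s in 𝓝[>] (0 : ℝ), ∃ α α' : Geo X,
      α' 0 = α 0 ∧ (α 0, α 1) ∈ M ∧ (α' 0, α' 1) ∈ M ∧ |dist (α 0) (α 1) - ℓ| ≤ η ∧
      |dist (α' 0) (α' 1) - ℓ'| ≤ η ∧ dist (α 0) (g.point s) ≤ η * s ∧
      1 / (k + 1) * s ≤ dist (α.point s) (α'.point s) := by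
    intro g hg η hη
    -- Rational length windows keep the family of branch sets countable while pinning the lengths of
    -- `α`, `α'` to within `η`.
    obtain ⟨a, ha1, ha2⟩ := exists_rat_btwn (sub_lt_self ℓ hη)
    obtain ⟨b, hb1, hb2⟩ := exists_rat_btwn (lt_add_of_pos_right ℓ hη)
    obtain ⟨a', ha1', ha2'⟩ := exists_rat_btwn (sub_lt_self ℓ' hη)
    obtain ⟨b', hb1', hb2'⟩ := exists_rat_btwn (lt_add_of_pos_right ℓ' hη)
    have hmem : γ 0 ∈ branchSet M k a b a' b' :=
      ⟨γ, γ', rfl, h0, hy, hy', ⟨ha2, hb1⟩, ⟨ha2', hb1'⟩, hk⟩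
    filter_upwards [hdens k a b a' b' hmem g hg η hη,
      Ioc_mem_nhdsGT (by positivity : (0 : ℝ) < 1 / (k + 1))] with s hs hsk
    obtain ⟨z, ⟨α, α', rfl, hα', hαM, hα'M, hαl, hα'l, hsep⟩, hz⟩ := hs
    refine ⟨α, α', hα', hαM, by rwa [hα'], abs_le.2 ⟨?_, ?_⟩, abs_le.2 ⟨?_, ?_⟩, hz,
      hsep s ⟨hsk.1.le, hsk.2⟩⟩
    · linarith [hαl.1]
    · linarith [hαl.2]
    · linarith [hα'l.1]
    · linarith [hα'l.2]
  -- Comparing `γ` with a nearby `α'` gives this bound; comparing `γ'` with a nearby `α` gives the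
  -- reverse one.
  have hle : ℓ ≤ ℓ' := by
    refine le_of_forall_small_time hxy fun ε hε hε1 => ?_
    obtain ⟨s, ⟨α, α', hα', -, hα'M, -, hl, hd, -⟩, hs0, hs1⟩ :=
      ((hnear γ rfl ε hε).and (Ioc_mem_nhdsGT hε)).exists
    rw [← hα'] at hd
    have := hM.dist_estimates hy hα'M ⟨hs0.le, hs1.trans hε1⟩ hd
    exact ⟨s, _, _, hs0, hs1, hl, dist_nonneg, this⟩
  have hge : ℓ' ≤ ℓ := by
    refine le_of_forall_small_time (hxy.trans_le hle) fun ε hε hε1 => ?_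
    obtain ⟨s, ⟨α, α', -, hαM, -, hl, -, hd, -⟩, hs0, hs1⟩ :=
      ((hnear γ' h0 ε hε).and (Ioc_mem_nhdsGT hε)).exists
    have := hM.dist_estimates (by rwa [h0]) hαM ⟨hs0.le, hs1.trans hε1⟩ hd
    exact ⟨s, _, _, hs0, hs1, hl, dist_nonneg, this⟩
  have heq : ℓ' = ℓ := le_antisymm hge hle
  rw [heq] at hnear
  obtain ⟨Y, _, _, _, hYtan, hYnb⟩ := htan
  obtain ⟨q₀, q₁, q₂, q₃, h01, h12, h13, h02, h03, h23⟩ :=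
    hYtan.exists_points (L := ℓ) (c := 1 / (k + 1)) hxy (fun η hη => by
      obtain ⟨ε, hε, hεη, hest⟩ := exists_forall_small_time_le
        (η := min (η / 2) (ℓ / 2)) (ℓ := ℓ) (lt_min (half_pos hη) (half_pos hxy))
        ((min_le_right _ _).trans_lt (half_lt_self hxy))
      have hη2 : min (η / 2) (ℓ / 2) ≤ η / 2 := min_le_left _ _
      filter_upwards [hnear γ rfl ε hε, Ioc_mem_nhdsGT hε, Ioc_mem_nhdsGT one_pos]
        with s hs hsε hs1
      have hs01 : s ∈ Icc (0 : ℝ) 1 := ⟨hs1.1.le, hs1.2⟩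
      obtain ⟨α, α', hα', hαM, hα'M, hl, hl', hd, hsep⟩ := hs
      have hup : ∀ β : Geo X, |dist (β 0) (β 1) - ℓ| ≤ ε →
          dist (β 0) (β.point s) ≤ (ℓ + η) * s := by
        intro β hβ
        rw [β.dist_zero_point hs01, mul_comm]
        have := (abs_le.1 hβ).2
        have := hs1.1
        gcongr
        linarith
      -- The almost minimizing bound at `β 1` is carried back to `β.point s` by subtracting the
      -- remaining length of `β`.
      have hlow : ∀ β : Geo X, (β 0, β 1) ∈ M → |dist (β 0) (β 1) - ℓ| ≤ ε →
          dist (β 0) (γ.point s) ≤ ε * s → (2 * ℓ - η) * s ≤ dist (γ 0) (β.point s) := by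
        intro β hβM hβ hβd
        obtain ⟨e1, e2⟩ := hM.dist_estimates hy hβM hs01 hβd
        have e3 := hest s _ _ hsε.1 hsε.2 hβ dist_nonneg dist_nonneg e1 e2
        have e4 := dist_triangle (γ 0) (β.point s) (β 1)
        rw [β.dist_point_one hs01] at e4
        have e5 : (2 * ℓ - η) * s ≤
            (dist (β 0) (β 1) + (ℓ - min (η / 2) (ℓ / 2))) * s := by
          have := (abs_le.1 hβ).1
          have := hs1.1
          gcongr
          linarith
        linarith
      refine ⟨α 0, α.point s, α'.point s, ?_, hup α hl, ?_, hlow α hαM hl hd,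
        hlow α' hα'M hl' (by rwa [hα']), hsep⟩
      · have e1 := dist_triangle_right (γ 0) (α 0) (γ.point s)
        rw [γ.dist_zero_point hs01] at e1
        have e2 : ε * s ≤ η * s := by
          have := hs1.1
          gcongr
          linarith
        linarith
      · have := hup α' hl'
        rwa [hα'] at this)
  have h23' : q₂ = q₃ := hYnb.eq_of_dist_le h01 h12 h13 h02 h03
  rw [h23', dist_self] at h23
  exact absurd h23 (not_le.2 (by positivity))

end Monotone

/-! ### Borel selection and conclusion. -/

/-- A closed set of pairs that is single-valued over almost every point is almost everywhere the
graph of a Borel map. -/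
lemma exists_measurable_map_of_ae_unique {X : Type u} [MetricSpace X] [CompleteSpace X]
    [TopologicalSpace.SeparableSpace X] [MeasurableSpace X] [BorelSpace X] {M : Set (X × X)}
    (hM : IsClosed M) {μ : Measure X}
    (h : ∀ᵐ x ∂μ, ∀ y y', (x, y) ∈ M → (x, y') ∈ M → y = y') :
    ∃ T : X → X, Measurable T ∧ ∀ᵐ x ∂μ, ∀ y, (x, y) ∈ M → y = T x := by
  have : SecondCountableTopology X := UniformSpace.secondCountable_of_separable X
  have : PolishSpace X := {}
  obtain ⟨N, hsub, hN, hN0⟩ := exists_measurable_superset_of_null (ae_iff.1 h)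
  set S : Set (X × X) := M ∩ Prod.fst ⁻¹' Nᶜ with hS
  have hSm : MeasurableSet S := hM.measurableSet.inter (measurable_fst hN.compl)
  have : StandardBorelSpace S := hSm.standardBorel
  -- Off the null set `N` the first projection is injective on a Borel set, hence a measurable
  -- embedding by Lusin–Souslin; `T` extends the second coordinate from its image.
  have hinj : Function.Injective fun p : S => (p : X × X).1 := by
    rintro ⟨⟨x, y⟩, hp, hxN⟩ ⟨⟨x', y'⟩, hp', _⟩ hxx'
    obtain rfl : x = x' := hxx'
    have hx : ∀ y y', (x, y) ∈ M → (x, y') ∈ M → y = y' := by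
      by_contra hcon
      exact hxN (hsub hcon)
    have := hx y y' hp hp'
    subst this
    rfl
  have hmeas : Measurable fun p : S => (p : X × X).1 := measurable_fst.comp measurable_subtype_coe
  obtain ⟨T, hT, hTS⟩ := (hmeas.measurableEmbedding hinj).exists_measurable_extend
    (measurable_snd.comp measurable_subtype_coe) (fun x => ⟨x⟩)
  refine ⟨T, hT, ?_⟩
  filter_upwards [compl_mem_ae_iff.2 hN0] with x hx y hxy
  exact (congrFun hTS ⟨(x, y), hxy, hx⟩).symm

/-- An optimal geodesic plan with absolutely continuous initial marginal is induced by a map. The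
proof blows up at density points of the set where the plan is multivalued: monotonicity forces two
geodesics issuing from a nearby point to extend a common one, so that the tangent space branches.
No assumption on the intermediate marginals is needed. -/
lemma IsOptimalGeodesicPlan.exists_measurable_map {X : Type u} [MetricSpace X] [CompleteSpace X]
    [TopologicalSpace.SeparableSpace X] [MeasurableSpace X] [BorelSpace X]
    (hX : IsStronglyNonBranching X) {m : Measure X} (hm : IsDoublingMeasure m)
    {μ ν : Measure X} [IsProbabilityMeasure μ] (hμ : μ ≪ m)
    (ha : ∀ᵐ x ∂m, HasNonBranchingTangentAt X x)
    {π : Measure (Geo X)} (hπ : IsOptimalGeodesicPlan π μ ν) :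
    ∃ T : X → X, Measurable T ∧ ∀ᵐ γ ∂π, γ 1 = T (γ 0) := by
  have : SecondCountableTopology X := UniformSpace.secondCountable_of_separable X
  have := hπ.prob
  have hm0 : m ≠ 0 := by
    rintro rfl
    exact IsProbabilityMeasure.ne_zero μ (Measure.absolutelyContinuous_zero_iff.1 hμ)
  have := hm.properSpace hm0
  have heval : ∀ t : I, Measurable (Geo.eval t : Geo X → X) := fun t =>
    Continuous.measurable ((continuous_eval_const t).comp
      (Isometry.of_dist_eq (f := Geo.toMap (X := X)) fun _ _ => rfl).continuous)
  have he : Measurable fun γ : Geo X => (Geo.eval 0 γ, Geo.eval 1 γ) :=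
    (heval 0).prodMk (heval 1)
  set q : Measure (X × X) := π.map fun γ => (Geo.eval 0 γ, Geo.eval 1 γ) with hq
  have hqplan : q ∈ transportPlans μ ν := by
    refine ⟨Measure.isProbabilityMeasure_map he.aemeasurable, ?_, ?_⟩
    · rw [hq, Measure.map_map measurable_fst he, ← hπ.map_zero]; rfl
    · rw [hq, Measure.map_map measurable_snd he, ← hπ.map_one]; rfl
  have hcost : ∫⁻ p, edist p.1 p.2 ^ 2 ∂q = W2 μ ν ^ 2 := by
    rw [hq, lintegral_map (by fun_prop) he]
    exact hπ.cost_eq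
  have hopt : ∫⁻ p, edist p.1 p.2 ^ 2 ∂q =
      ⨅ q ∈ transportPlans μ ν, ∫⁻ p, edist p.1 p.2 ^ 2 ∂q := by
    rw [hcost, W2, ← ENNReal.rpow_natCast, ← ENNReal.rpow_mul]
    norm_num
  have hM : IsDistSqMonotone q.support := fun a ha b hb =>
    dist_sq_add_le_of_mem_support hqplan hopt (hcost ▸ hπ.cost_lt_top.ne) ha hb
  have hdens : ∀ᵐ x ∂m, ∀ k a b a' b', x ∈ branchSet q.support k a b a' b' →
      IsGeodesicallyDense (branchSet q.support k a b a' b') x := by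
    simp only [ae_all_iff]
    exact fun k a b a' b' => hm.ae_isGeodesicallyDense _
  have huniq : ∀ᵐ x ∂m, ∀ y y', (x, y) ∈ q.support → (x, y') ∈ q.support → y = y' := by
    filter_upwards [ha, hdens] with x hx hxd y y' hy hy'
    exact hM.eq_of_isGeodesicallyDense hX hy hy' hxd hx
  obtain ⟨T, hT, hTM⟩ := exists_measurable_map_of_ae_unique Measure.isClosed_support
    (hμ.ae_le huniq)
  refine ⟨T, hT, ?_⟩
  rw [← hπ.map_zero] at hTM
  have hsupp : ∀ᵐ p ∂q, p ∈ q.support := Measure.support_mem_ae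
  filter_upwards [ae_of_ae_map (heval 0).aemeasurable hTM, ae_of_ae_map he.aemeasurable hsupp]
    with γ h1 h2 using h1 _ h2

theorem theorem4p3 {X : Type u} [MetricSpace X] [CompleteSpace X]
    [TopologicalSpace.SeparableSpace X] [MeasurableSpace X] [BorelSpace X]
    (hX : IsStronglyNonBranching X)
    (m : Measure X) (hm : IsDoublingMeasure m)
    (μ ν : Measure X) [IsProbabilityMeasure μ] [IsProbabilityMeasure ν]
    (ρ : X → ℝ≥0∞) (hρ : Measurable ρ) (hμ : μ = m.withDensity ρ)
    (hW : W2 μ ν < ∞)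
    (ha : ∀ᵐ x ∂m, HasNonBranchingTangentAt X x)
    (π : Measure (Geo X)) (hπ : IsOptimalGeodesicPlan π μ ν)
    (hac : ∃ s₀ : ℝ, 0 < s₀ ∧ ∀ s : I, (s : ℝ) < 1 → (s : ℝ) < s₀ → π.map (Geo.eval s) ≪ m)
    (hent : limsup (fun s : I => entropyIntegral m ((π.map (Geo.eval s)).rnDeriv m))
      (𝓝[>] (0 : I)) < ⊤) :
    ∃ T : X → X, Measurable T ∧ ∀ᵐ γ ∂π, γ 1 = T (γ 0) := by
  exact hπ.exists_measurable_map hX hm (hμ ▸ withDensity_absolutelyContinuous m ρ) ha
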